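/- Let $K$ be an algebraically closed field. An algebraic group over $K$ is a group object in the category of $K$-schemes whose underlying scheme is reduced and of finite type over $K$; such a $V$ is identified with its group of $K$-points. For a finite set $E$, an algebraic subgroup of $V^E$ is a subgroup of $V(K)^E$ that is closed in the Zariski topology of the product variety $V^E$. Let $G$ be a group, acting on $V^G=V(K)^G$ by $(gx)(h)=x(g^{-1}h)$. A subset $\Sigma\subset V^G$ is an algebraic group subshift of finite type if there are a finite subset $D\subset G$ and an algebraic subgroup $W\subset V^D$ such that $$\Sigma=\{x\in V^G : (g^{-1}x)|_D\in W \text{ for all } g\in G\}.$$ For algebraic groups $U,V$ over $K$, a map $\tau\colon U^G\to V^G$ is an algebraic group cellular automaton if there are a finite subset $M\subset G$ and a homomorphism of $K$-algebraic groups $\mu\colon U^M\to V$ such that $\tau(x)(g)=\mu((g^{-1}x)|_M)$ for all $x\in U^G$ and $g\in G$. A subset $\Sigma\subset V^G$ is an algebraic group sofic subshift if there are a $K$-algebraic group $U$, an algebraic group subshift of finite type $\Sigma'\subset U^G$ and an algebraic group cellular automaton $\tau\colon U^G\to V^G$ with $\Sigma=\tau(\Sigma')$. **Corollary.** Let $G$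 be a polycyclic-by-finite group, i.e. a group with a normal subgroup $N$ of finite index that admits a finite chain of subgroups $1=N_0\subset N_1\subset\cdots\subset N_n=N$ with each $N_{k-1}$ normal in $N_k$ and $N_k/N_{k-1}$ cyclic. Let $V$ be an algebraic group over an algebraically closed field $K$, and let $\Sigma$ be an algebraic group sofic subshift of $V^G$. Then $\Sigma$ is an algebraic group subshift of finite type of $V^G$. -/

import Mathlib

open CategoryTheory AlgebraicGeometry

universe u v w

noncomputable section

/-! ### Polycyclic-by-finite groups -/

/-- `G` is polycyclic: there is a finite chain `1 = H 0 ≤ H 1 ≤ ⋯ ≤ H n = G` of subgroups in which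
each `H k` is normal in `H (k + 1)` with cyclic quotient `H (k + 1) / H k`. -/
def IsPolycyclicGroup (G : Type v) [Group G] : Prop :=
  ∃ (n : ℕ) (H : ℕ → Subgroup G), H 0 = ⊥ ∧ H n = ⊤ ∧
    ∀ k < n, H k ≤ H (k + 1) ∧
      ∃ _ : ((H k).subgroupOf (H (k + 1))).Normal,
        IsCyclic (↥(H (k + 1)) ⧸ (H k).subgroupOf (H (k + 1)))

/-- `G` is polycyclic-by-finite: it has a polycyclic normal subgroup of finite index. -/
def IsPolycyclicByFinite (G : Type v) [Group G] : Prop :=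
  ∃ N : Subgroup G, N.Normal ∧ N.FiniteIndex ∧ IsPolycyclicGroup N

/-! ### Algebraic groups -/

/-- An algebraic group over `K` (used for `K` algebraically closed): a group object in the category
of `K`-schemes whose underlying scheme is reduced and of finite type over `K`. -/
structure AlgGroup (K : Type u) [Field K] where
  /-- the underlying `K`-scheme -/
  X : Over (Spec (.of K))
  [grp : GrpObj X]
  [reduced : IsReduced X.left]
  [locallyOfFiniteType : LocallyOfFiniteType X.hom]
  [quasiCompact : QuasiCompact X.hom]

namespace AlgGroup

attribute [instance] AlgGroup.grp AlgGroup.reduced AlgGroup.locallyOfFiniteType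
  AlgGroup.quasiCompact

variable {K : Type u} [Field K]

/-- The set `V(K)` of `K`-points of an algebraic group `V`. -/
abbrev Points (V : AlgGroup K) : Type u :=
  Over.mk (𝟙 (Spec (.of K))) ⟶ V.X

/-- The group structure on `V(K)` induced by that of the group object `V`. -/
instance (V : AlgGroup K) : Group V.Points := Hom.group

/-- The power `V ^ ι` as a `K`-scheme (the product is taken over `Spec K`). -/
abbrev pow (V : AlgGroup K) (ι : Type w) [Finite ι] : Over (Spec (.of K)) :=
  ∏ᶜ fun _ : ι => V.X

/-- The identification of `V(K) ^ ι` with the set of `K`-points of `V ^ ι`: the `K`-point of the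
product with the given coordinates. -/
def powPoint (V : AlgGroup K) {ι : Type w} [Finite ι] (x : ι → V.Points) :
    Over.mk (𝟙 (Spec (.of K))) ⟶ V.pow ι :=
  Limits.Pi.lift x

/-- The topological point of `V ^ ι` underlying an element of `V(K) ^ ι`. -/
def powTopPoint (V : AlgGroup K) {ι : Type w} [Finite ι] (x : ι → V.Points) :
    (V.pow ι).left :=
  (V.powPoint x).left (IsLocalRing.closedPoint K)

/-- A subset of `V(K) ^ ι` is Zariski closed if it is cut out by a closed subset of the scheme
`V ^ ι` (so the Zariski topology is that of `V ^ ι`, not the product topology). -/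
def IsZariskiClosed (V : AlgGroup K) {ι : Type w} [Finite ι] (S : Set (ι → V.Points)) : Prop :=
  ∃ Z : Set (V.pow ι).left, IsClosed Z ∧ S = {x | V.powTopPoint x ∈ Z}

/-- A subset of `V(K) ^ ι` is an algebraic subgroup of `V ^ ι` if it is a subgroup and is
Zariski closed. -/
def IsAlgSubgroup (V : AlgGroup K) {ι : Type w} [Finite ι] (W : Set (ι → V.Points)) : Prop :=
  (∃ H : Subgroup (ι → V.Points), (H : Set (ι → V.Points)) = W) ∧ V.IsZariskiClosed W

/-- A map `μ : U(K) ^ ι → V(K)` is a homomorphism of algebraic groups `U ^ ι → V` if it is a group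
homomorphism and is given by a morphism of `K`-schemes `U ^ ι ⟶ V`. -/
def IsAlgHom (U V : AlgGroup K) {ι : Type w} [Finite ι] (μ : (ι → U.Points) → V.Points) : Prop :=
  (∀ x y, μ (x * y) = μ x * μ y) ∧ ∃ f : U.pow ι ⟶ V.X, ∀ x, μ x = U.powPoint x ≫ f

end AlgGroup

/-! ### Shift spaces -/

/-- The shift action `(g x)(h) = x (g⁻¹ h)` of `G` on configurations. -/
def shift {G : Type v} [Group G] {A : Type w} (g : G) (x : G → A) : G → A :=
  fun h => x (g⁻¹ * h)

/-- The restriction of a configuration to a finite set `D`. -/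
def restrictTo {G : Type v} {A : Type w} (D : Finset G) (x : G → A) : D → A :=
  fun h => x h

/-- The subshift of finite type `Σ(A^G; D, P)`. -/
def subshiftOfFiniteType {G : Type v} [Group G] {A : Type w} (D : Finset G) (P : Set (D → A)) :
    Set (G → A) :=
  {x | ∀ g : G, restrictTo D (shift g⁻¹ x) ∈ P}

variable {K : Type u} [Field K]

/-- Algebraic group subshifts of finite type of `V ^ G`. -/
def IsAlgGroupSFT (G : Type v) [Group G] (V : AlgGroup K) (S : Set (G → V.Points)) : Prop :=
  ∃ (D : Finset G) (W : Set (D → V.Points)), V.IsAlgSubgroup W ∧ S = subshiftOfFiniteType D W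

/-- Algebraic group cellular automata `U ^ G → V ^ G`. -/
def IsAlgGroupCA (G : Type v) [Group G] (U V : AlgGroup K)
    (τ : (G → U.Points) → (G → V.Points)) : Prop :=
  ∃ (M : Finset G) (μ : (M → U.Points) → V.Points), AlgGroup.IsAlgHom U V μ ∧
    ∀ (x : G → U.Points) (g : G), τ x g = μ (restrictTo M (shift g⁻¹ x))

/-- Algebraic group sofic subshifts of `V ^ G`: images of algebraic group subshifts of finite type
of `U ^ G`, for some `K`-algebraic group `U`, under algebraic group cellular automata. -/
def IsAlgGroupSofic (G : Type v) [Group G] (V : AlgGroup K) (S : Set (G → V.Points)) : Prop :=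
  ∃ (U : AlgGroup K) (S' : Set (G → U.Points)) (τ : (G → U.Points) → (G → V.Points)),
    IsAlgGroupSFT G U S' ∧ IsAlgGroupCA G U V τ ∧ S = τ '' S'

end

/-! Linear compactness takes the place of compactness. Call a subgroup of `V(K)^G` a cylinder if it
is the preimage of an algebraic subgroup of `V^E` for some finite `E`, and closed if it is an
intersection of cylinders. Powers of `V` are Noetherian, so algebraic subgroups satisfy the
descending chain condition. Over an algebraically closed field, Chevalley's theorem makes their
images under homomorphisms algebraic again (`IsAlgSubgroup.map`). It follows that a nonempty family
of cosets of cylinders that is stable under intersection has a common point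
(`IsCosetBase.exists_forall_mem`), so a sofic subshift, the image of a closed subgroup, is itself
closed (`IsClosedSubgroup.map_sup_vanish`).

It remains to show that a closed shift-invariant subgroup `Γ` is of finite type. The subshifts of
finite type cut out by the restrictions of `Γ` to finite sets `E` decrease to `Γ` as `E` grows, so a
descending chain condition on closed invariant subgroups makes one of them equal to `Γ`
(`CylinderSystem.exists_window`).

This chain condition is proved along the polycyclic series in the manner of Hilbert's basis theorem
(`DCC.of_cyclic_extension`). If `t` generates `H'` modulo `H`, attach to `Γ` its leading parts: the
restrictions to one `H`-slice of the elements of `Γ` trivial on the preceding `n` slices. They are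
`H`-invariant and decrease both in `n` and along the chain, so they stabilise uniformly in `n`.
Nested groups with equal leading parts coincide. -/

noncomputable section

/-! ### Zariski topology and images of algebraic subgroups -/

/-- The preimage of a constructible set under a continuous map has nowhere dense frontier. -/
lemma Topology.IsConstructible.interior_frontier_preimage {X Y : Type*} [TopologicalSpace X]
    [TopologicalSpace Y] {s : Set X} (hs : Topology.IsConstructible s) {g : Y → X}
    (hg : Continuous g) : interior (frontier (g ⁻¹' s)) = ∅ := by
  induction hs using Topology.IsConstructible.empty_union_induction with
  | open_retrocompact U hU _ => 
    rw [← frontier_compl]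
    exact interior_frontier (hU.preimage hg).isClosed_compl
  | union s hs t ht ihs iht =>
    refine Set.eq_empty_of_subset_empty ?_
    have h : interior (frontier (g ⁻¹' s) ∪ frontier (g ⁻¹' t)) = ∅ := by
      rw [interior_union_isClosed_of_interior_empty isClosed_frontier iht, ihs]
    rw [← h, Set.preimage_union]
    exact interior_mono ((frontier_union_subset _ _).trans
      (Set.union_subset_union Set.inter_subset_left Set.inter_subset_right))
  | compl s hs ih => rwa [Set.preimage_compl, frontier_compl]

/-- A set with nowhere dense frontier in a nonempty space in which it is dense has nonempty
interior. -/
lemma Dense.nonempty_interior_of_frontier {Y : Type*} [TopologicalSpace Y] [Nonempty Y] {s : Set Y}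
    (hs : Dense s) (h : interior (frontier s) = ∅) : (interior s).Nonempty := by
  rw [Set.nonempty_iff_ne_empty]
  intro h0
  rw [frontier, h0, hs.closure_eq] at h
  simp at h

/-- In a group with a topology for which translations and inversion are continuous, a subgroup
which is the preimage of a constructible set is closed. -/
lemma Subgroup.isClosed_of_isConstructible {A X : Type*} [Group A] [TopologicalSpace A]
    [TopologicalSpace X] (hl : ∀ a : A, Continuous (a * ·)) (hr : ∀ a : A, Continuous (· * a))
    (hi : Continuous fun a : A => a⁻¹) (H : Subgroup A) {g : A → X} (hg : Continuous g)
    {s : Set X} (hs : Topology.IsConstructible s) (hH : (H : Set A) = g ⁻¹' s) :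
    IsClosed (H : Set A) := by
  set C : Set A := _root_.closure (H : Set A) with hC
  have hHC : (H : Set A) ⊆ C := _root_.subset_closure
  have hmulH : ∀ a ∈ H, ∀ c ∈ C, a * c ∈ C := fun a ha c hc =>
    map_mem_closure (hl a) hc fun x hx => H.mul_mem ha hx
  let B := {x // x ∈ C}
  have : Nonempty B := ⟨⟨1, hHC H.one_mem⟩⟩
  let T : Set B := Subtype.val ⁻¹' (H : Set A)
  have hT : Dense T := by
    intro b
    rw [closure_subtype, Set.image_preimage_eq_of_subset (by simpa using hHC)]
    exact b.2
  -- The frontier is taken inside the closure `C`, where `H` is dense; this forces `H` to contain a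
  -- nonempty relatively open subset of `C`.
  have hfr : interior (frontier T) = ∅ := by
    have := hs.interior_frontier_preimage (g := fun b : B => g b.1)
      (hg.comp continuous_subtype_val)
    have hTs : T = (fun b : B => g b.1) ⁻¹' s := by simp only [T, hH]; rfl
    rwa [hTs]
  obtain ⟨b, hb⟩ := hT.nonempty_interior_of_frontier hfr
  obtain ⟨O, hO, hbO, hOT⟩ : ∃ O : Set A, IsOpen O ∧ b.1 ∈ O ∧ ∀ x ∈ O, x ∈ C → x ∈ H := by
    obtain ⟨O', hO', hO'o, hbO'⟩ := mem_interior.1 hb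
    obtain ⟨O, hO, rfl⟩ := isOpen_induced_iff.1 hO'o
    exact ⟨O, hO, hbO', fun x hx hxC => hO' (show (⟨x, hxC⟩ : B) ∈ _ from hx)⟩
  have hbH : b.1 ∈ H := hOT _ hbO b.2
  have hCinv : ∀ c ∈ C, c⁻¹ ∈ C := fun c hc => map_mem_closure hi hc fun x hx => H.inv_mem hx
  refine isClosed_of_closure_subset fun c hc => ?_
  have hmulC : ∀ d ∈ C, d * c⁻¹ ∈ C := fun d hd => by
    have : ∀ e ∈ C, ∀ d ∈ C, d * e ∈ C := fun e he d hd => by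
      have h := map_mem_closure (f := (· * e)) (t := C) (hr e) hd fun x hx => hmulH x hx e he
      rwa [isClosed_closure.closure_eq] at h
    exact this _ (hCinv c hc) d hd
  -- The map `x ↦ b * (x⁻¹ * c)` sends `c` to `b`, so the preimage of `O` is a neighbourhood of `c`
  -- and meets `H`. Only separate continuity is used: the Zariski topology is not a group topology.
  obtain ⟨x, hx1, hx2⟩ := mem_closure_iff.1 hc ((fun x => b.1 * (x⁻¹ * c)) ⁻¹' O)
    (hO.preimage (((hl b.1).comp (hr c)).comp hi |>.congr fun x => rfl)) (by simpa using hbO)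
  have h1 : b.1 * (x⁻¹ * c) ∈ H := hOT _ hx1 (hmulH _ hbH _ (hmulH _ (H.inv_mem hx2) _ hc))
  have h2 := H.mul_mem hx2 (H.mul_mem (H.inv_mem hbH) h1)
  simpa using h2

namespace AlgGroup

variable {K : Type u} [Field K]

/-- A class of morphisms stable under base change and composition and containing identities is
inherited by finite products over the base. -/
lemma _root_.CategoryTheory.MorphismProperty.overObj_isClosedUnderFiniteProducts
    (P : MorphismProperty Scheme.{u}) [P.IsMultiplicative] [P.IsStableUnderBaseChange]
    (S : Scheme.{u}) : (P.overObj (X := S)).IsClosedUnderFiniteProducts := by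
  have hbin : (P.overObj (X := S)).IsClosedUnderBinaryProducts := by
    constructor
    rintro X ⟨p⟩
    let A := p.diag.obj ⟨.left⟩
    let B := p.diag.obj ⟨.right⟩
    have hP : P (Limits.pullback.fst A.hom B.hom ≫ A.hom) :=
      P.comp_mem _ _ (P.pullback_fst _ _ (p.prop_diag_obj _)) (p.prop_diag_obj _)
    have e : X ≅ MonoidalCategoryStruct.tensorObj A B :=
      Limits.IsLimit.conePointUniqueUpToIso
        ((Limits.IsLimit.postcomposeHomEquiv (Limits.diagramIsoPair p.diag) _).symm p.isLimit)
        (CartesianMonoidalCategory.tensorProductIsBinaryProduct A B)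
    exact (P.overObj (X := S)).prop_of_iso e.symm hP
  exact .mk'

lemma locallyOfFiniteType_and_quasiCompact_pow (V : AlgGroup K) (ι : Type w) [Finite ι] :
    LocallyOfFiniteType (V.pow ι).hom ∧ QuasiCompact (V.pow ι).hom := by
  have h1 := MorphismProperty.overObj_isClosedUnderFiniteProducts @LocallyOfFiniteType
    (Spec (.of K))
  have h2 := MorphismProperty.overObj_isClosedUnderFiniteProducts @QuasiCompact (Spec (.of K))
  exact ⟨ObjectProperty.prop_product (MorphismProperty.overObj @LocallyOfFiniteType)
      fun _ : ι => V.locallyOfFiniteType,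
    ObjectProperty.prop_product (MorphismProperty.overObj @QuasiCompact)
      fun _ : ι => V.quasiCompact⟩

instance (V : AlgGroup K) (ι : Type w) [Finite ι] : LocallyOfFiniteType (V.pow ι).hom :=
  (V.locallyOfFiniteType_and_quasiCompact_pow ι).1

instance (V : AlgGroup K) (ι : Type w) [Finite ι] : QuasiCompact (V.pow ι).hom :=
  (V.locallyOfFiniteType_and_quasiCompact_pow ι).2

instance (V : AlgGroup K) (ι : Type w) [Finite ι] : IsNoetherian (V.pow ι).left := by
  have := LocallyOfFiniteType.isLocallyNoetherian (V.pow ι).hom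
  have : CompactSpace (V.pow ι).left := 
    QuasiCompact.compactSpace_of_compactSpace (V.pow ι).hom
  exact {}

variable {ι : Type w} {κ : Type v} [Finite ι] [Finite κ]

@[simp]
lemma powPoint_π (V : AlgGroup K) (x : ι → V.Points) (i : ι) :
    V.powPoint x ≫ Limits.Pi.π (fun _ : ι => V.X) i = x i := by
  simp [powPoint]

/-- Every `K`-point of `V ^ ι` is determined by its coordinates. -/
lemma powPoint_surjective (V : AlgGroup K) :
    Function.Surjective (V.powPoint (ι := ι)) := fun p =>
  ⟨fun i => p ≫ Limits.Pi.π _ i, by ext i; simp [powPoint]⟩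

/-- The Zariski topology on `V(K) ^ ι`. -/
abbrev zariski (V : AlgGroup K) (ι : Type w) [Finite ι] : TopologicalSpace (ι → V.Points) :=
  .induced V.powTopPoint inferInstance

lemma isZariskiClosed_iff (V : AlgGroup K) {S : Set (ι → V.Points)} :
    V.IsZariskiClosed S ↔ @IsClosed _ (V.zariski ι) S := by
  rw [isClosed_induced_iff]
  exact ⟨fun ⟨Z, h, e⟩ => ⟨Z, h, e.symm⟩, fun ⟨Z, h, e⟩ => ⟨Z, h, e.symm⟩⟩

/-- A map between sets of `K`-points of powers which is induced by a morphism of `K`-schemes. -/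
def IsRegular (U V : AlgGroup K) (φ : (ι → U.Points) → (κ → V.Points)) : Prop :=
  ∃ f : U.pow ι ⟶ V.pow κ, ∀ x, V.powPoint (φ x) = U.powPoint x ≫ f

lemma isRegular_of_coord {U V : AlgGroup K} {φ : (ι → U.Points) → (κ → V.Points)}
    (h : ∀ j, ∃ f : U.pow ι ⟶ V.X, ∀ x, φ x j = U.powPoint x ≫ f) : IsRegular U V φ := by
  choose f hf using h
  refine ⟨Limits.Pi.lift f, fun x => ?_⟩
  ext1 j
  simp [hf]

lemma isRegular_reindex (V : AlgGroup K) (σ : κ → ι) :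
    IsRegular V V (fun (x : ι → V.Points) j => x (σ j)) :=
  isRegular_of_coord fun j => ⟨Limits.Pi.π _ (σ j), fun x => by simp⟩

instance (V : AlgGroup K) (Y : Over (Spec (.of K))) : Group (Y ⟶ V.X) := Hom.group

lemma isRegular_mul_left (V : AlgGroup K) (a : ι → V.Points) : IsRegular V V (a * ·) :=
  isRegular_of_coord fun j => ⟨(Over.mkIdTerminal.from _ ≫ a j) * Limits.Pi.π _ j, fun x => by
    rw [MonObj.comp_mul, ← Category.assoc, Over.mkIdTerminal.hom_ext (_ ≫ _) (𝟙 _)]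
    simp⟩

lemma isRegular_mul_right (V : AlgGroup K) (a : ι → V.Points) : IsRegular V V (· * a) :=
  isRegular_of_coord fun j => ⟨Limits.Pi.π _ j * (Over.mkIdTerminal.from _ ≫ a j), fun x => by
    rw [MonObj.comp_mul, ← Category.assoc, Over.mkIdTerminal.hom_ext (_ ≫ _) (𝟙 _)]
    simp⟩

lemma isRegular_inv (V : AlgGroup K) : IsRegular V V (fun x : ι → V.Points => x⁻¹) :=
  isRegular_of_coord fun j => ⟨(Limits.Pi.π _ j)⁻¹, fun x => by
    rw [GrpObj.comp_inv]
    simp⟩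

lemma powTopPoint_of_hom {U V : AlgGroup K} {φ : (ι → U.Points) → (κ → V.Points)}
    {f : U.pow ι ⟶ V.pow κ} (hf : ∀ x, V.powPoint (φ x) = U.powPoint x ≫ f) (x : ι → U.Points) :
    V.powTopPoint (φ x) = f.left (U.powTopPoint x) := by
  simp only [powTopPoint, hf]
  rfl

lemma IsRegular.continuous {U V : AlgGroup K} {φ : (ι → U.Points) → (κ → V.Points)}
    (h : IsRegular U V φ) : @Continuous _ _ (U.zariski ι) (V.zariski κ) φ := by
  obtain ⟨f, hf⟩ := h
  let := U.zariski ι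
  rw [continuous_induced_rng]
  have : V.powTopPoint ∘ φ = f.left ∘ U.powTopPoint := funext (powTopPoint_of_hom hf)
  rw [this]
  exact f.left.continuous.comp continuous_induced_dom

lemma IsAlgSubgroup.comap {U V : AlgGroup K} (φ : (ι → U.Points) →* (κ → V.Points))
    (hφ : IsRegular U V φ) {W : Subgroup (κ → V.Points)}
    (hW : V.IsAlgSubgroup (W : Set (κ → V.Points))) :
    U.IsAlgSubgroup (W.comap φ : Set (ι → U.Points)) := by
  refine ⟨⟨_, rfl⟩, ?_⟩
  have := hW.2
  rw [isZariskiClosed_iff] at this ⊢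
  exact @IsClosed.preimage _ _ (U.zariski ι) (V.zariski κ) _ hφ.continuous _ this

lemma IsAlgSubgroup.inf (V : AlgGroup K) {W W' : Subgroup (ι → V.Points)}
    (hW : V.IsAlgSubgroup (W : Set (ι → V.Points)))
    (hW' : V.IsAlgSubgroup (W' : Set (ι → V.Points))) :
    V.IsAlgSubgroup ((W ⊓ W' : Subgroup _) : Set (ι → V.Points)) := by
  refine ⟨⟨_, rfl⟩, ?_⟩
  have h := hW.2
  have h' := hW'.2
  rw [isZariskiClosed_iff] at h h' ⊢
  exact @IsClosed.inter _ _ _ (V.zariski ι) h h'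

/-- The powers are Noetherian schemes, and the Zariski topology on points is induced from them. All
later chain conditions rest on this one. -/
lemma wellFoundedLT_isAlgSubgroup (V : AlgGroup K) (ι : Type w) [Finite ι] :
    WellFoundedLT {W : Subgroup (ι → V.Points) // V.IsAlgSubgroup (W : Set (ι → V.Points))} := by
  let := V.zariski ι
  have : TopologicalSpace.NoetherianSpace (ι → V.Points) :=
    Topology.IsInducing.noetherianSpace (i := V.powTopPoint) ⟨rfl⟩
  have : WellFoundedLT (TopologicalSpace.Closeds (ι → V.Points)) :=
    inferInstance
  let F : {W : Subgroup (ι → V.Points) // V.IsAlgSubgroup (W : Set (ι → V.Points))} →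
      TopologicalSpace.Closeds (ι → V.Points) :=
    fun W => ⟨(W.1 : Set _), V.isZariskiClosed_iff.1 W.2.2⟩
  have hF : StrictMono F := fun W W' h => h
  exact hF.wellFoundedLT

/-! ### Closed points and images over an algebraically closed field -/

section IsAlgClosed

variable [IsAlgClosed K]

/-- By the Nullstellensatz, the `K`-points of a scheme locally of finite type over `K` are exactly
its closed points; this lemma and the next two unpack that bijection. -/
lemma isClosed_powTopPoint (V : AlgGroup K) (x : ι → V.Points) :
    IsClosed {V.powTopPoint x} :=
  (pointEquivClosedPoint (V.pow ι).hom ⟨(V.powPoint x).left, Over.w (V.powPoint x)⟩).2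

lemma powTopPoint_injective (V : AlgGroup K) :
    Function.Injective (V.powTopPoint (ι := ι)) := fun x y h => by
  have h1 : V.powPoint x = V.powPoint y := by
    apply Over.OverMorphism.ext
    exact ext_of_apply_closedPoint_eq (V.pow ι).hom (Over.w (V.powPoint x))
      (Over.w (V.powPoint y)) h
  funext i
  rw [← V.powPoint_π x, h1, powPoint_π]

lemma exists_powTopPoint_eq (V : AlgGroup K) {p : (V.pow ι).left} (hp : IsClosed {p}) :
    ∃ x : ι → V.Points, V.powTopPoint x = p := by
  obtain ⟨q, hq⟩ := (pointEquivClosedPoint (V.pow ι).hom).surjective ⟨p, hp⟩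
  obtain ⟨x, hx⟩ := V.powPoint_surjective (Over.homMk (U := Over.mk (𝟙 _)) q.1 q.2)
  refine ⟨x, ?_⟩
  rw [powTopPoint, hx]
  exact congrArg Subtype.val hq

lemma isZariskiClosed_singleton (V : AlgGroup K) (x : ι → V.Points) : V.IsZariskiClosed {x} :=
  ⟨_, V.isClosed_powTopPoint x, by ext y; simp [V.powTopPoint_injective.eq_iff]⟩

/-- The image of an algebraic subgroup under a regular homomorphism is an algebraic subgroup. -/
lemma IsAlgSubgroup.map {U V : AlgGroup K} (φ : (ι → U.Points) →* (κ → V.Points))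
    (hφ : IsRegular U V φ) {W : Subgroup (ι → U.Points)}
    (hW : U.IsAlgSubgroup (W : Set (ι → U.Points))) :
    V.IsAlgSubgroup (W.map φ : Set (κ → V.Points)) := by
  refine ⟨⟨_, rfl⟩, ?_⟩
  obtain ⟨-, Z, hZ, hWZ⟩ := hW
  obtain ⟨f, hf⟩ := hφ
  have hft : LocallyOfFiniteType (f.left ≫ (V.pow κ).hom) := by
    rw [Over.w]; infer_instance
  have : LocallyOfFiniteType f.left :=
    locallyOfFiniteType_of_comp _ (V.pow κ).hom
  have : LocallyOfFinitePresentation f.left :=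
    LocallyOfFinitePresentation.iff_locallyOfFiniteType.2 this
  have hcons : Topology.IsConstructible (f.left '' Z) := by
    refine Scheme.Hom.isConstructible_image _ ?_
    rw [← Topology.isConstructible_compl]
    exact (TopologicalSpace.NoetherianSpace.isCompact _).isConstructible hZ.isOpen_compl
  let := V.zariski κ
  rw [isZariskiClosed_iff]
  refine Subgroup.isClosed_of_isConstructible (fun a => (V.isRegular_mul_left a).continuous)
    (fun a => (V.isRegular_mul_right a).continuous) V.isRegular_inv.continuous _
    continuous_induced_dom hcons ?_
  ext y
  constructor
  · rintro ⟨x, hx, rfl⟩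
    exact ⟨U.powTopPoint x, by rw [hWZ] at hx; exact hx, (powTopPoint_of_hom hf x).symm⟩
  · rintro ⟨p, hp, hpy⟩
    -- Chevalley only gives some scheme point `p` of `Z` over `y`. The part of the fibre in `Z` is
    -- closed and nonempty, hence contains a closed point, which is a `K`-point.
    have hcl : IsClosed (Z ∩ f.left ⁻¹' {V.powTopPoint y}) :=
      hZ.inter ((V.isClosed_powTopPoint y).preimage f.left.continuous)
    obtain ⟨q, ⟨hqZ, hq⟩, hqc⟩ :=
      hcl.exists_closed_singleton ⟨p, hp, hpy⟩
    obtain ⟨x, rfl⟩ := U.exists_powTopPoint_eq hqc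
    refine ⟨x, by rw [hWZ]; exact hqZ, V.powTopPoint_injective ?_⟩
    rw [powTopPoint_of_hom hf]
    exact hq

lemma isAlgSubgroup_bot (V : AlgGroup K) :
    V.IsAlgSubgroup ((⊥ : Subgroup (ι → V.Points)) : Set (ι → V.Points)) :=
  ⟨⟨_, rfl⟩, by simpa using V.isZariskiClosed_singleton 1⟩

end IsAlgClosed

end AlgGroup

/-! ### Linearly compact systems of cylinder subgroups -/

/-- The configurations which are trivial on `Y`. -/
def vanish {X : Type v} {A : Type u} [Group A] (Y : Set X) : Subgroup (X → A) where
  carrier := {x | ∀ i ∈ Y, x i = 1}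
  mul_mem' ha hb i hi := by simp [ha i hi, hb i hi]
  one_mem' _ _ := rfl
  inv_mem' ha i hi := by simp [ha i hi]

section vanish

variable {X : Type v} {A : Type u} [Group A]

lemma mem_vanish {Y : Set X} {x : X → A} : x ∈ vanish Y ↔ ∀ i ∈ Y, x i = 1 := Iff.rfl

lemma vanish_anti {Y Z : Set X} (h : Y ⊆ Z) : vanish (A := A) Z ≤ vanish Y :=
  fun _ hx i hi => hx i (h hi)

instance vanish_normal (Y : Set X) : (vanish (A := A) Y).Normal where
  conj_mem x hx g i hi := by simp [hx i hi]

/-- Adding `vanish Y` encodes projection to the coordinates in `Y` without leaving the full product.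
-/
lemma mem_sup_vanish {Y : Set X} {Γ : Subgroup (X → A)} {x : X → A} :
    x ∈ Γ ⊔ vanish Y ↔ ∃ γ ∈ Γ, ∀ i ∈ Y, γ i = x i := by
  rw [Subgroup.mem_sup_of_normal_right]
  constructor
  · rintro ⟨γ, hγ, z, hz, rfl⟩
    exact ⟨γ, hγ, fun i hi => by simp [mem_vanish.1 hz i hi]⟩
  · rintro ⟨γ, hγ, h⟩
    exact ⟨γ, hγ, γ⁻¹ * x, fun i hi => by simp [h i hi], by simp⟩

end vanish

/-- A family of "cylinder" subgroups of `X → A`, each determined by finitely many coordinates,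
closed under intersections and projections, and satisfying the descending chain condition for each
finite set of coordinates. -/
structure CylinderSystem (X : Type v) (A : Type u) [Group A] where
  /-- the cylinder subgroups -/
  cyl : Subgroup (X → A) → Prop
  exists_support : ∀ {Γ}, cyl Γ → ∃ E : Finset X, vanish (E : Set X) ≤ Γ
  inf : ∀ {Γ Δ}, cyl Γ → cyl Δ → cyl (Γ ⊓ Δ)
  cyl_vanish : ∀ E : Finset X, cyl (vanish (E : Set X))
  sup_vanish : ∀ {Γ}, cyl Γ → ∀ E : Finset X, cyl (Γ ⊔ vanish (E : Set X))
  exists_minimal : ∀ (E : Finset X) (𝒢 : Set (Subgroup (X → A))), 𝒢.Nonempty →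
    (∀ Γ ∈ 𝒢, cyl Γ ∧ vanish (E : Set X) ≤ Γ) → ∃ Γ, Minimal (· ∈ 𝒢) Γ

/-- `s` is a left coset of the subgroup `Γ`. -/
def IsCosetOf {P : Type w} [Group P] (Γ : Subgroup P) (s : Set P) : Prop :=
  s.Nonempty ∧ ∀ a ∈ s, ∀ x, x ∈ s ↔ a⁻¹ * x ∈ Γ

lemma IsCosetOf.inter {P : Type w} [Group P] {Γ Δ : Subgroup P} {s t : Set P}
    (hs : IsCosetOf Γ s) (ht : IsCosetOf Δ t) (h : (s ∩ t).Nonempty) :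
    IsCosetOf (Γ ⊓ Δ) (s ∩ t) :=
  ⟨h, fun a ha x => by
    rw [Set.mem_inter_iff, hs.2 a ha.1, ht.2 a ha.2, Subgroup.mem_inf]⟩

lemma isCosetOf_comap {P Q : Type*} [Group P] [Group Q] (φ : P →* Q) (Δ : Subgroup Q) {y : Q}
    (h : ∃ x, y⁻¹ * φ x ∈ Δ) : IsCosetOf (Δ.comap φ) {x | y⁻¹ * φ x ∈ Δ} :=
  ⟨h, fun a ha x => by
    have e : φ (a⁻¹ * x) = (y⁻¹ * φ a)⁻¹ * (y⁻¹ * φ x) := by simp [mul_assoc]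
    rw [Subgroup.mem_comap, e, Subgroup.mul_mem_cancel_left _ (inv_mem ha)]
    rfl⟩

namespace CylinderSystem

variable {X : Type v} {A : Type u} [Group A] (c : CylinderSystem X A)

lemma cyl_top : c.cyl ⊤ := by
  have : vanish (A := A) ((∅ : Finset X) : Set X) = ⊤ := by
    ext; simp [mem_vanish]
  exact this ▸ c.cyl_vanish ∅

/-- A family of cosets of cylinder subgroups which is closed under intersections. -/
def IsCosetBase (𝓑 : Set (Set (X → A))) : Prop :=
  (∀ s ∈ 𝓑, ∃ Γ, c.cyl Γ ∧ IsCosetOf Γ s) ∧ ∀ s ∈ 𝓑, ∀ t ∈ 𝓑, s ∩ t ∈ 𝓑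

lemma isCosetOf_eval (i : X) (a : A) :
    IsCosetOf (vanish (({i} : Finset X) : Set X)) {x : X → A | x i = a} :=
  ⟨⟨fun _ => a, rfl⟩, fun b hb x => by
    have hb : b i = a := hb
    simp [mem_vanish, hb, inv_mul_eq_one, eq_comm]⟩

/-- In a maximal base of cosets each coordinate is determined. -/
lemma IsCosetBase.exists_eval_of_maximal {M : Set (Set (X → A))} (hM : Maximal c.IsCosetBase M)
    (hne : M.Nonempty) (i : X) : ∃ a, ∃ s ∈ M, ∀ p ∈ s, p i = a := by
  let v : Subgroup (X → A) := vanish (({i} : Finset X) : Set X)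
  obtain ⟨hcos, hint⟩ := hM.prop
  -- Choose `s` in `M` whose direction group has minimal projection to coordinate `i`. Intersecting
  -- with any `t` in `M` cannot shrink that projection, so `t` meets the slice `x i = p i` for every
  -- `p` in `s`; maximality then puts these slices in `M`.
  obtain ⟨_, ⟨s, hs, Γ, hΓ, hsΓ, rfl⟩, hmin⟩ := c.exists_minimal {i}
    {Δ | ∃ s ∈ M, ∃ Γ, c.cyl Γ ∧ IsCosetOf Γ s ∧ Δ = Γ ⊔ v}
    (by
      obtain ⟨s, hs⟩ := hne
      obtain ⟨Γ, hΓ, h⟩ := hcos s hs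
      exact ⟨_, s, hs, Γ, hΓ, h, rfl⟩)
    (by
      rintro _ ⟨s, hs, Γ, hΓ, h, rfl⟩
      exact ⟨c.sup_vanish hΓ _, le_sup_right⟩)
  obtain ⟨p, hp⟩ := hsΓ.1
  have hmeet : ∀ t ∈ M, (t ∩ {x | x i = p i}).Nonempty := by
    intro t ht
    obtain ⟨Δ, hΔ, htΔ⟩ := hcos t ht
    have hst := hint s hs t ht
    obtain ⟨Δ', -, hΔ'⟩ := hcos _ hst
    have hcst := hsΓ.inter htΔ hΔ'.1
    obtain ⟨q, hq⟩ := hcst.1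
    have hle := hmin ⟨s ∩ t, hst, _, c.inf hΓ hΔ, hcst, rfl⟩ (sup_le_sup_right inf_le_left v)
    have hqp : q⁻¹ * p ∈ Γ ⊔ v := Subgroup.mem_sup_left ((hsΓ.2 q hq.1 p).1 hp)
    obtain ⟨γ, hγ, h⟩ := mem_sup_vanish.1 (hle hqp)
    refine ⟨q * γ, ((hcst.2 q hq (q * γ)).2 (by simpa using hγ)).2, ?_⟩
    have := h i (by simp)
    simp [this]
  let N : Set (Set (X → A)) := M ∪ (fun t => t ∩ {x | x i = p i}) '' M
  have hN : c.IsCosetBase N := by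
    constructor
    · rintro _ (ht | ⟨t, ht, rfl⟩)
      · exact hcos _ ht
      · obtain ⟨Δ, hΔ, htΔ⟩ := hcos t ht
        exact ⟨_, c.inf hΔ (c.cyl_vanish {i}), htΔ.inter (isCosetOf_eval i _) (hmeet t ht)⟩
    · rintro _ (ht | ⟨t, ht, rfl⟩) _ (hu | ⟨u, hu, rfl⟩)
      · exact Or.inl (hint _ ht _ hu)
      · exact Or.inr ⟨_, hint _ ht _ hu, by ext; simp; tauto⟩
      · exact Or.inr ⟨_, hint _ ht _ hu, by ext; simp; tauto⟩
      · exact Or.inr ⟨_, hint _ ht _ hu, by ext; simp; tauto⟩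
  exact ⟨p i, s ∩ {x | x i = p i}, hM.le_of_ge hN Set.subset_union_left (Or.inr ⟨s, hs, rfl⟩),
    fun q hq => hq.2⟩

/-- Linear compactness: a base of cosets of cylinder subgroups has a common point. -/
theorem IsCosetBase.exists_forall_mem {𝓑 : Set (Set (X → A))} (h : c.IsCosetBase 𝓑)
    (hne : 𝓑.Nonempty) : ∃ x, ∀ s ∈ 𝓑, x ∈ s := by
  obtain ⟨M, hBM, hM⟩ := zorn_subset_nonempty {𝓑 | c.IsCosetBase 𝓑}
    (fun C hC hchain _ => ⟨⋃₀ C, ⟨fun s ⟨𝓐, h𝓐, hs⟩ => (hC h𝓐).1 s hs,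
      fun s ⟨𝓐, h𝓐, hs⟩ t ⟨𝓓, h𝓓, ht⟩ => by
        rcases hchain.total h𝓐 h𝓓 with hle | hle
        · exact ⟨𝓓, h𝓓, (hC h𝓓).2 s (hle hs) t ht⟩
        · exact ⟨𝓐, h𝓐, (hC h𝓐).2 s hs t (hle ht)⟩⟩,
      fun s hs => Set.subset_sUnion_of_mem hs⟩) 𝓑 h
  obtain ⟨hcos, hint⟩ := hM.prop
  have hMne := hne.mono hBM
  choose x t ht htx using IsCosetBase.exists_eval_of_maximal c hM hMne
  refine ⟨x, fun s hs => ?_⟩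
  have hagree : ∀ E : Finset X, ∃ u ∈ M, ∀ p ∈ u, ∀ i ∈ E, p i = x i := by
    classical
    intro E
    induction E using Finset.induction_on with
    | empty => exact ⟨s, hBM hs, by simp⟩
    | insert a E _ ih =>
      obtain ⟨u, hu, h⟩ := ih
      refine ⟨u ∩ t a, hint _ hu _ (ht a), fun p hp i hi => ?_⟩
      rcases Finset.mem_insert.1 hi with rfl | hi
      · exact htx _ p hp.2
      · exact h p hp.1 i hi
  obtain ⟨Γ, hΓ, hsΓ⟩ := hcos s (hBM hs)
  obtain ⟨E, hE⟩ := c.exists_support hΓ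
  obtain ⟨u, hu, h⟩ := hagree E
  obtain ⟨_, -, ⟨p, hp⟩, -⟩ := hcos _ (hint s (hBM hs) u hu)
  exact (hsΓ.2 p hp.1 x).2 (hE fun i hi => by simp [h p hp.2 i hi])

/-- A subgroup is closed if it is an intersection of cylinder subgroups. -/
def IsClosedSubgroup (Γ : Subgroup (X → A)) : Prop :=
  ∀ x, (∀ Δ, c.cyl Δ → Γ ≤ Δ → x ∈ Δ) → x ∈ Γ

variable {c}

lemma isClosedSubgroup_of_cyl {Γ : Subgroup (X → A)} (h : c.cyl Γ) : c.IsClosedSubgroup Γ :=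
  fun _ hx => hx Γ h le_rfl

lemma IsClosedSubgroup.iInf {ι : Sort*} {Γ : ι → Subgroup (X → A)}
    (h : ∀ i, c.IsClosedSubgroup (Γ i)) : c.IsClosedSubgroup (⨅ i, Γ i) := fun x hx =>
  Subgroup.mem_iInf.2 fun i => h i x fun Δ hΔ hle => hx Δ hΔ ((iInf_le _ i).trans hle)

lemma IsClosedSubgroup.inf {Γ Δ : Subgroup (X → A)} (h : c.IsClosedSubgroup Γ)
    (h' : c.IsClosedSubgroup Δ) : c.IsClosedSubgroup (Γ ⊓ Δ) := fun x hx =>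
  ⟨h x fun Θ hΘ hle => hx Θ hΘ (inf_le_left.trans hle),
    h' x fun Θ hΘ hle => hx Θ hΘ (inf_le_right.trans hle)⟩

variable (c) in
lemma isClosedSubgroup_vanish (Y : Set X) : c.IsClosedSubgroup (vanish Y) := fun x hx i hi =>
  hx _ (c.cyl_vanish {i}) (vanish_anti (by simpa using hi)) i (by simp)

/-- All cylinders above `Γ` have support in `E`, so there is a minimal one. Intersecting it with any
other shows that it is the least, hence equal to `Γ`. -/
lemma IsClosedSubgroup.cyl_of_vanish_le {Γ : Subgroup (X → A)} (h : c.IsClosedSubgroup Γ)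
    (E : Finset X) (hE : vanish (E : Set X) ≤ Γ) : c.cyl Γ := by
  obtain ⟨Δ, ⟨hΔ, hΓΔ⟩, hmin⟩ := c.exists_minimal E {Δ | c.cyl Δ ∧ Γ ≤ Δ} ⟨⊤, c.cyl_top, le_top⟩
    fun Δ hΔ => ⟨hΔ.1, hE.trans hΔ.2⟩
  have : Δ ≤ Γ := fun x hx => h x fun Θ hΘ hle =>
    (hmin ⟨c.inf hΔ hΘ, le_inf hΓΔ hle⟩ inf_le_left hx).2
  rwa [le_antisymm hΓΔ this]

/-- Images of closed subgroups, and their projections to arbitrary sets of coordinates, are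
closed. -/
theorem IsClosedSubgroup.map_sup_vanish {X' : Type*} {B : Type*} [Group B]
    {d : CylinderSystem X' B} (φ : (X → A) →* (X' → B))
    (hcomap : ∀ E : Finset X', c.cyl ((vanish (E : Set X')).comap φ))
    (hmap : ∀ Γ, c.cyl Γ → ∀ E : Finset X', d.cyl (Γ.map φ ⊔ vanish (E : Set X')))
    {Γ : Subgroup (X → A)} (h : c.IsClosedSubgroup Γ) (Y : Set X') :
    d.IsClosedSubgroup (Γ.map φ ⊔ vanish Y) := by
  classical
  intro y hy
  -- A common point of these cosets is an `x` in every cylinder above `Γ`, hence in `Γ`, with `φ x =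
  -- y` on `Y`. Each finite instance is solvable because `y` lies in every cylinder above `Γ.map φ ⊔
  -- vanish Y`.
  let 𝓑 : Set (Set (X → A)) := {s | ∃ Δ, c.cyl Δ ∧ Γ ≤ Δ ∧ ∃ E : Finset X', (E : Set X') ⊆ Y ∧
    s = (Δ : Set (X → A)) ∩ {x | y⁻¹ * φ x ∈ vanish (E : Set X')}}
  have hB : c.IsCosetBase 𝓑 := by
    constructor
    · rintro _ ⟨Δ, hΔ, hle, E, hE, rfl⟩
      have hyΔ : y ∈ Δ.map φ ⊔ vanish (E : Set X') :=
        hy _ (hmap Δ hΔ E) (sup_le_sup (Subgroup.map_mono hle) (vanish_anti hE))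
      obtain ⟨_, ⟨x, hx, rfl⟩, hxy⟩ := mem_sup_vanish.1 hyΔ
      have hx' : y⁻¹ * φ x ∈ vanish (E : Set X') := fun i hi => by simp [hxy i hi]
      refine ⟨_, c.inf hΔ (hcomap E), IsCosetOf.inter ⟨⟨1, Δ.one_mem⟩, fun a ha z => ?_⟩
        (isCosetOf_comap φ _ ⟨x, hx'⟩) ⟨x, hx, hx'⟩⟩
      exact (Subgroup.mul_mem_cancel_left _ (inv_mem ha)).symm
    · rintro _ ⟨Δ, hΔ, hle, E, hE, rfl⟩ _ ⟨Δ', hΔ', hle', E', hE', rfl⟩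
      refine ⟨_, c.inf hΔ hΔ', le_inf hle hle', E ∪ E', by simp [hE, hE'], ?_⟩
      ext x
      simp only [Set.mem_inter_iff, SetLike.mem_coe, Set.mem_ofPred_eq, mem_vanish,
        Subgroup.mem_inf, Finset.coe_union, Set.mem_union, or_imp, forall_and]
      tauto
  obtain ⟨x, hx⟩ := hB.exists_forall_mem c ⟨_, ⊤, c.cyl_top, le_top, ∅, by simp, rfl⟩
  refine mem_sup_vanish.2 ⟨φ x, ⟨x, h x fun Δ hΔ hle =>
    (hx _ ⟨Δ, hΔ, hle, ∅, by simp, rfl⟩).1, rfl⟩, fun i hi => ?_⟩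
  have := (hx _ ⟨⊤, c.cyl_top, le_top, {i}, by simpa using hi, rfl⟩).2 i (by simp)
  exact (inv_mul_eq_one.1 this).symm

lemma IsClosedSubgroup.sup_vanish {Γ : Subgroup (X → A)} (h : c.IsClosedSubgroup Γ) (Y : Set X) :
    c.IsClosedSubgroup (Γ ⊔ vanish Y) := by
  have := h.map_sup_vanish (d := c) (MonoidHom.id _) (fun E => by simpa using c.cyl_vanish E)
    (fun Γ hΓ E => by simpa using c.sup_vanish hΓ E) Y
  simpa using this

end CylinderSystem

/-! ### Descending chains of invariant closed subgroups -/

/-- A two-parameter antitone family in a partial order with the descending chain condition is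
eventually constant in its first parameter, uniformly in the second one. -/
lemma exists_forall_eq_of_antitone₂ {α : Type*} [PartialOrder α] {p : α → Prop}
    (hp : ∀ f : ℕ → α, Antitone f → (∀ n, p (f n)) → ∃ N, ∀ m ≥ N, f m = f N)
    (g : ℕ → ℕ → α) (hg : ∀ m n, p (g m n)) (h₁ : ∀ n, Antitone fun m => g m n)
    (h₂ : ∀ m, Antitone (g m)) : ∃ N, ∀ m ≥ N, ∀ n, g m n = g N n := by
  -- The diagonal settles all `n ≥ N₀` at once; the finitely many remaining `n` are stabilised one
  -- at a time.
  obtain ⟨N₀, hN₀⟩ := hp (fun n => g n n) (fun a b hab => (h₁ b hab).trans (h₂ a hab))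
    fun n => hg n n
  have key : ∀ m ≥ N₀, ∀ n ≥ N₀, g m n = g N₀ N₀ := by
    intro m hm n hn
    apply le_antisymm ((h₁ n hm).trans (h₂ N₀ hn))
    rw [← hN₀ (max m n) (hm.trans (le_max_left _ _))]
    exact (h₁ _ (le_max_left m n)).trans (h₂ m (le_max_right m n))
  choose M hM using fun n => hp (fun m => g m n) (h₁ n) fun m => hg m n
  refine ⟨max N₀ ((Finset.range N₀).sup M), fun m hm n => ?_⟩
  have hN : N₀ ≤ max N₀ ((Finset.range N₀).sup M) := le_max_left _ _
  rcases le_or_gt N₀ n with hn | hn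
  · rw [key m (hN.trans hm) n hn, key _ hN n hn]
  · have hMn : M n ≤ max N₀ ((Finset.range N₀).sup M) :=
      (Finset.le_sup (Finset.mem_range.2 hn)).trans (le_max_right _ _)
    exact (hM n m (hMn.trans hm)).trans (hM n _ hMn).symm

section shift

variable {G : Type v} [Group G] {A : Type u} [Group A]

/-- The shift by `g` as a group homomorphism. -/
def shiftHom (g : G) : (G → A) →* (G → A) where
  toFun := shift g
  map_one' := rfl
  map_mul' _ _ := rfl

@[simp]
lemma shiftHom_apply (g : G) (x : G → A) (h : G) : shiftHom g x h = x (g⁻¹ * h) := rfl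

/-- The union of the orbits of the elements of `F` under left multiplication by `H`. -/
def orbitSet (H : Subgroup G) (F : Finset G) : Set G := {g | ∃ h ∈ H, ∃ f ∈ F, g = h * f}

lemma mul_mem_orbitSet {H : Subgroup G} {F : Finset G} {h z : G} (hh : h ∈ H)
    (hz : z ∈ orbitSet H F) : h * z ∈ orbitSet H F := by
  obtain ⟨k, hk, f, hf, rfl⟩ := hz
  exact ⟨h * k, H.mul_mem hh hk, f, hf, by group⟩

namespace CylinderSystem

variable (c : CylinderSystem G A)

/-- Closed subgroups which are invariant under `H` and determined by finitely many `H`-orbits of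
coordinates. -/
def IsInvariantClosed (H : Subgroup G) (F : Finset G) (Γ : Subgroup (G → A)) : Prop :=
  c.IsClosedSubgroup Γ ∧ (∀ h ∈ H, Γ ≤ Γ.comap (shiftHom h)) ∧ vanish (orbitSet H F) ≤ Γ

/-- The descending chain condition for `H`-invariant closed subgroups. -/
def DCC (H : Subgroup G) : Prop :=
  ∀ (F : Finset G) (f : ℕ → Subgroup (G → A)), Antitone f →
    (∀ n, c.IsInvariantClosed H F (f n)) → ∃ N, ∀ m ≥ N, f m = f N

lemma dcc_bot : c.DCC (⊥ : Subgroup G) := by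
  intro F f hf hinv
  have hF : orbitSet (⊥ : Subgroup G) F = F := by
    ext z
    simp [orbitSet]
  obtain ⟨_, ⟨N, rfl⟩, hN⟩ := c.exists_minimal F (Set.range f) ⟨_, 0, rfl⟩ (by
    rintro _ ⟨n, rfl⟩
    have h := (hinv n).2.2
    rw [hF] at h
    exact ⟨(hinv n).1.cyl_of_vanish_le F h, h⟩)
  exact ⟨N, fun m hm => le_antisymm (hf hm) (hN ⟨m, rfl⟩ (hf hm))⟩

/-- Since `H' ⊆ H T`, finitely many `H'`-orbits are covered by the finitely many `H`-orbits of `T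
F`. -/
lemma DCC.of_finite_cover {c : CylinderSystem G A} {H H' : Subgroup G} (h : c.DCC H) (hle : H ≤ H')
    (T : Finset G) (hT : ∀ g ∈ H', ∃ k ∈ H, ∃ t ∈ T, g = k * t) : c.DCC H' := by
  classical
  intro F f hf hinv
  refine h (Finset.image₂ (· * ·) T F) f hf fun n => ⟨(hinv n).1,
    fun k hk => (hinv n).2.1 k (hle hk), (vanish_anti ?_).trans (hinv n).2.2⟩
  rintro _ ⟨g, hg, z, hz, rfl⟩
  obtain ⟨k, hk, t, ht, rfl⟩ := hT g hg
  exact ⟨k, hk, t * z, Finset.mem_image₂_of_mem ht hz, by group⟩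

/-! ### Leading parts and cyclic extensions -/

section cyclic

variable {c} {H H' : Subgroup G} {t : G} (F : Finset G)

/-- The union of the translates of `orbitSet H F` by `t⁻¹, …, t⁻ⁿ`. -/
def pastSet (H : Subgroup G) (t : G) (F : Finset G) (n : ℕ) : Set G :=
  {z | ∃ k : ℕ, 1 ≤ k ∧ k ≤ n ∧ t ^ k * z ∈ orbitSet H F}

/-- The restrictions to `orbitSet H F` of the elements of `Γ` which are trivial on the preceding
`n` translates. -/
def leadingPart (H : Subgroup G) (t : G) (F : Finset G) (Γ : Subgroup (G → A)) (n : ℕ) :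
    Subgroup (G → A) :=
  (Γ ⊓ vanish (pastSet H t F n)) ⊔ vanish (orbitSet H F)

lemma leadingPart_mono {Γ Δ : Subgroup (G → A)} (h : Γ ≤ Δ) (n : ℕ) :
    leadingPart H t F Γ n ≤ leadingPart H t F Δ n :=
  sup_le_sup_right (inf_le_inf_right _ h) _

lemma pastSet_mono : Monotone (pastSet H t F) :=
  fun _ _ hab _ ⟨k, h1, h2, h3⟩ => ⟨k, h1, h2.trans hab, h3⟩

lemma leadingPart_antitone (Γ : Subgroup (G → A)) : Antitone (leadingPart H t F Γ) :=
  fun _ _ hab => sup_le_sup_right (inf_le_inf_left _ (vanish_anti (pastSet_mono F hab))) _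

variable (hle : H ≤ H') (ht : t ∈ H') (hconj : ∀ g ∈ H', ∀ h ∈ H, g * h * g⁻¹ ∈ H)

-- `H'` normalises `H`, so each translate by a power of `t` of an `H`-stable set is again
-- `H`-stable; triviality on the past survives shifts by `H`.
include hle ht hconj in
lemma isInvariantClosed_leadingPart {Γ : Subgroup (G → A)} {F' : Finset G}
    (hΓ : c.IsInvariantClosed H' F' Γ) (n : ℕ) :
    c.IsInvariantClosed H F (leadingPart H t F Γ n) := by
  refine ⟨(hΓ.1.inf (c.isClosedSubgroup_vanish _)).sup_vanish _, fun h hh x hx => ?_, le_sup_right⟩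
  obtain ⟨γ, ⟨hγ, hγv⟩, hγx⟩ := mem_sup_vanish.1 hx
  refine mem_sup_vanish.2 ⟨shiftHom h γ, ⟨hΓ.2.1 h (hle hh) hγ, ?_⟩,
    fun z hz => hγx _ (mul_mem_orbitSet (H.inv_mem hh) hz)⟩
  rintro z ⟨k, hk1, hk2, hk⟩
  refine hγv _ ⟨k, hk1, hk2, ?_⟩
  have := mul_mem_orbitSet (hconj (t ^ k) (H'.pow_mem ht k) h⁻¹ (H.inv_mem hh)) hk
  convert this using 1
  group

/-- The union of the translates of `orbitSet H F` by `1, t, …, tⁿ⁻¹`. -/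
def windowSet (H : Subgroup G) (t : G) (F : Finset G) (n : ℕ) : Set G :=
  {z | ∃ k : ℕ, k < n ∧ (t ^ k)⁻¹ * z ∈ orbitSet H F}

include ht in
/-- If two nested invariant subgroups have the same leading parts, they have the same restrictions
to all windows. -/
lemma exists_eq_on_windowSet {Γ Δ : Subgroup (G → A)} {F' : Finset G} (hle : Γ ≤ Δ)
    (hΓ : c.IsInvariantClosed H' F' Γ) (hΔ : c.IsInvariantClosed H' F' Δ)
    (hlead : ∀ n, leadingPart H t F Δ n ≤ leadingPart H t F Γ n) {x : G → A} (hx : x ∈ Δ) (n : ℕ) :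
    ∃ y ∈ Γ, ∀ z ∈ windowSet H t F n, y z = x z := by
  induction n with
  | zero => exact ⟨1, Γ.one_mem, fun z ⟨k, hk, _⟩ => absurd hk (Nat.not_lt_zero k)⟩
  | succ n ih =>
    obtain ⟨y, hy, hyx⟩ := ih
    -- The error `y⁻¹ * x` is trivial on the slices already matched. Shifted back by `t ^ n`, it has
    -- these slices as its past, so its leading part is realised in `Γ` by some `w` that corrects
    -- the next slice without disturbing the earlier ones.
    have hδ : shiftHom (t ^ n)⁻¹ (y⁻¹ * x) ∈ leadingPart H t F Δ n := by
      refine Subgroup.mem_sup_left ⟨hΔ.2.1 _ (H'.inv_mem (H'.pow_mem ht n))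
        (Δ.mul_mem (Δ.inv_mem (hle hy)) hx), ?_⟩
      rintro z ⟨k, hk1, hk2, hk⟩
      have hw : (t ^ n)⁻¹⁻¹ * z ∈ windowSet H t F n := by
        refine ⟨n - k, by omega, ?_⟩
        convert hk using 1
        obtain ⟨j, rfl⟩ := Nat.exists_eq_add_of_le hk2
        rw [Nat.add_sub_cancel_left, inv_inv, ← mul_assoc, add_comm, pow_add,
          inv_mul_cancel_left]
      rw [shiftHom_apply, Pi.mul_apply, Pi.inv_apply, hyx _ hw, inv_mul_cancel]
    obtain ⟨w, ⟨hw, hwv⟩, hwδ⟩ := mem_sup_vanish.1 (hlead n hδ)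
    refine ⟨y * shiftHom (t ^ n) w, Γ.mul_mem hy (hΓ.2.1 _ (H'.pow_mem ht n) hw), ?_⟩
    rintro z ⟨k, hk, hz⟩
    rcases Nat.lt_succ_iff_lt_or_eq.1 hk with hk | rfl
    · have : (t ^ n)⁻¹ * z ∈ pastSet H t F n := by
        refine ⟨n - k, by omega, by omega, ?_⟩
        convert hz using 1
        obtain ⟨j, rfl⟩ := Nat.exists_eq_add_of_le hk.le
        rw [Nat.add_sub_cancel_left, ← mul_assoc, pow_add, mul_inv_rev,
          mul_inv_cancel_left]
      rw [Pi.mul_apply, shiftHom_apply, hwv _ this, mul_one, hyx z ⟨k, hk, hz⟩]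
    · rw [Pi.mul_apply, shiftHom_apply, hwδ _ hz]
      simp

include hle ht hconj in
/-- The descending chain condition passes to extensions by cyclic groups. -/
theorem DCC.of_cyclic_extension (h : c.DCC H) (hcyc : ∀ g ∈ H', ∃ k : ℤ, (t ^ k)⁻¹ * g ∈ H) :
    c.DCC H' := by
  classical
  intro F f hf hinv
  obtain ⟨N, hN⟩ := exists_forall_eq_of_antitone₂ (h F) (fun m n => leadingPart H t F (f m) n)
    (fun m n => isInvariantClosed_leadingPart F hle ht hconj (hinv m) n)
    (fun n a b hab => leadingPart_mono F (hf hab) n) fun m => leadingPart_antitone F (f m)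
  refine ⟨N, fun m hm => le_antisymm (hf hm) fun x hx => (hinv m).1 x fun Δ hΔ hmΔ => ?_⟩
  obtain ⟨E, hE⟩ := c.exists_support hΔ
  -- The finite set `E` meets slices with exponents in `[-n, n]` only; translation by `t ^ n` moves
  -- them to `[0, 2n]`. The slices need not be disjoint, so `t` may have finite order modulo `H`.
  have hbound : ∃ n : ℕ, ∀ z ∈ E, z ∈ orbitSet H' F → (t ^ n) * z ∈ windowSet H t F (2 * n + 1) := by
    have hk : ∀ z, ∃ k : ℤ, z ∈ orbitSet H' F → (t ^ k)⁻¹ * z ∈ orbitSet H F := by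
      intro z
      by_cases hz : z ∈ orbitSet H' F
      · obtain ⟨g, hg, f, hf, rfl⟩ := hz
        obtain ⟨k, hk⟩ := hcyc g hg
        exact ⟨k, fun _ => ⟨_, hk, f, hf, by group⟩⟩
      · exact ⟨0, fun h => absurd h hz⟩
    choose k hk using hk
    refine ⟨E.sup fun z => (k z).natAbs, fun z hzE hz => ?_⟩
    have hkz : (k z).natAbs ≤ E.sup fun z => (k z).natAbs :=
      Finset.le_sup (f := fun z => (k z).natAbs) hzE
    set n := E.sup fun z => (k z).natAbs
    refine ⟨(k z + n).toNat, by omega, ?_⟩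
    convert hk z hz using 1
    have : ((k z + n).toNat : ℤ) = k z + n := Int.toNat_of_nonneg (by omega)
    rw [← zpow_natCast, this, ← zpow_natCast, ← mul_assoc]
    congr 1
    group
  obtain ⟨n, hn⟩ := hbound
  obtain ⟨y, hy, hyx⟩ := exists_eq_on_windowSet F ht (hf hm) (hinv m) (hinv N)
    (fun k => (hN m hm k).ge) ((hinv N).2.1 _ (H'.pow_mem ht n) hx) (2 * n + 1)
  have hy' : shiftHom (t ^ n)⁻¹ y ∈ f m := (hinv m).2.1 _ (H'.inv_mem (H'.pow_mem ht n)) hy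
  have heq : ∀ z ∈ E, z ∈ orbitSet H' F → shiftHom (t ^ n)⁻¹ y z = x z := by
    intro z hzE hz
    rw [shiftHom_apply, inv_inv, hyx _ (hn z hzE hz)]
    simp
  -- Off `orbitSet H' F` the group `f m` imposes no condition, so the values of `x` may be used
  -- there.
  have hx' : (fun z => if z ∈ orbitSet H' F then shiftHom (t ^ n)⁻¹ y z else x z) ∈ f m := by
    rw [← sup_eq_left.2 (hinv m).2.2]
    exact mem_sup_vanish.2 ⟨_, hy', fun z hz => by rw [if_pos hz]⟩
  rw [← sup_eq_left.2 hE]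
  refine mem_sup_vanish.2 ⟨_, hmΔ hx', fun z hz => ?_⟩
  split_ifs with hz'
  · exact heq z hz hz'
  · rfl

end cyclic

end CylinderSystem

end shift

/-! ### The chain condition for polycyclic-by-finite groups and finite windows -/

section polycyclic

variable {G : Type v} [Group G] {A : Type w} [Group A] (c : CylinderSystem G A)

/-- The descending chain condition passes up a subnormal step with cyclic quotient. -/
lemma CylinderSystem.DCC.of_isCyclic_quotient {N : Subgroup G} {L L' : Subgroup N} (hle : L ≤ L')
    (hnor : (L.subgroupOf L').Normal) (hcyc : IsCyclic (↥L' ⧸ L.subgroupOf L'))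
    (h : c.DCC (L.map N.subtype)) : c.DCC (L'.map N.subtype) := by
  obtain ⟨q, hq⟩ := hcyc.exists_generator
  obtain ⟨t, rfl⟩ := QuotientGroup.mk_surjective q
  refine CylinderSystem.DCC.of_cyclic_extension (t := (t : N)) (Subgroup.map_mono hle)
    ⟨t, t.2, rfl⟩ ?_ h ?_
  · rintro _ ⟨g, hg, rfl⟩ _ ⟨k, hk, rfl⟩
    have := hnor.conj_mem ⟨k, hle hk⟩ (Subgroup.mem_subgroupOf.2 hk) ⟨g, hg⟩
    exact ⟨g * k * g⁻¹, Subgroup.mem_subgroupOf.1 this, rfl⟩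
  · rintro _ ⟨g, hg, rfl⟩
    obtain ⟨k, hk⟩ := hq (QuotientGroup.mk ⟨g, hg⟩)
    refine ⟨k, ((t : N) ^ k)⁻¹ * g, ?_, by simp⟩
    have : (QuotientGroup.mk (t ^ k) : ↥L' ⧸ L.subgroupOf L') = QuotientGroup.mk ⟨g, hg⟩ := hk
    simpa [Subgroup.mem_subgroupOf] using QuotientGroup.eq.1 this

lemma CylinderSystem.dcc_of_isPolycyclicGroup {N : Subgroup G} (hN : IsPolycyclicGroup N) :
    c.DCC N := by
  obtain ⟨n, H, h0, hn, hH⟩ := hN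
  have key : ∀ k ≤ n, c.DCC ((H k).map N.subtype) := by
    intro k hk
    induction k with
    | zero => rw [h0, Subgroup.map_bot]; exact c.dcc_bot
    | succ k ih =>
      obtain ⟨hle, hnor, hcyc⟩ := hH k hk
      exact CylinderSystem.DCC.of_isCyclic_quotient c hle hnor hcyc (ih (Nat.le_of_succ_le hk))
  have := key n le_rfl
  rwa [hn, ← MonoidHom.range_eq_map, Subgroup.range_subtype] at this

/-- Closed shift-invariant subgroups over a polycyclic-by-finite group satisfy the descending chain
condition. -/
theorem CylinderSystem.dcc_top_of_isPolycyclicByFinite (hG : IsPolycyclicByFinite G) :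
    c.DCC (⊤ : Subgroup G) := by
  classical
  obtain ⟨N, -, hfin, hN⟩ := hG
  have : Fintype (G ⧸ N) := Fintype.ofFinite _
  -- The cover needs factors of `N` on the left, so inverses of left coset representatives are used.
  refine (c.dcc_of_isPolycyclicGroup hN).of_finite_cover le_top
    (Finset.univ.image fun q : G ⧸ N => (q.out)⁻¹) fun g _ => ?_
  refine ⟨g * (QuotientGroup.mk g⁻¹ : G ⧸ N).out, ?_, _,
    Finset.mem_image_of_mem _ (Finset.mem_univ (QuotientGroup.mk g⁻¹)), by group⟩
  simpa using QuotientGroup.eq.1 (QuotientGroup.out_eq' (QuotientGroup.mk g⁻¹ : G ⧸ N)).symm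

/-- An invariant closed subgroup over a group with the descending chain condition is determined by
its restriction to a finite window. -/
theorem CylinderSystem.exists_window (hshift : ∀ Γ, c.cyl Γ → ∀ g, c.cyl (Γ.comap (shiftHom g)))
    (hdcc : c.DCC (⊤ : Subgroup G)) {Γ : Subgroup (G → A)} (hΓ : c.IsClosedSubgroup Γ)
    (hinv : ∀ g, Γ ≤ Γ.comap (shiftHom g)) :
    ∃ E : Finset G, Γ = ⨅ g, (Γ ⊔ vanish (E : Set G)).comap (shiftHom g) := by
  classical
  let S : Finset G → Subgroup (G → A) := fun E => ⨅ g, (Γ ⊔ vanish (E : Set G)).comap (shiftHom g)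
  have hshift' : ∀ Δ, c.IsClosedSubgroup Δ → ∀ g, c.IsClosedSubgroup (Δ.comap (shiftHom g)) :=
    fun Δ hΔ g x hx => hΔ _ fun Θ hΘ hle => hx _ (hshift Θ hΘ g) (Subgroup.comap_mono hle)
  have hmem : ∀ E x, x ∈ S E ↔ ∀ g, shiftHom g x ∈ Γ ⊔ vanish (E : Set G) := fun E x => by
    simp [S, Subgroup.mem_iInf]
  have hS : ∀ E, c.IsInvariantClosed ⊤ {1} (S E) := by
    refine fun E => ⟨CylinderSystem.IsClosedSubgroup.iInf fun g =>
      hshift' _ (hΓ.sup_vanish _) g, fun h _ x hx => (hmem _ _).2 fun g => ?_, fun x hx => ?_⟩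
    · have := (hmem _ _).1 hx (g * h)
      convert this using 1
      funext z
      simp [mul_assoc]
    · have : x = 1 := funext fun i => hx i ⟨i, trivial, 1, by simp, by simp⟩
      rw [this]
      exact one_mem _
  have hΓS : ∀ E, Γ ≤ S E := fun E x hx =>
    (hmem _ _).2 fun g => Subgroup.mem_sup_left (hinv g hx)
  have hanti : ∀ {E E'}, E ⊆ E' → S E' ≤ S E := fun {E E'} h x hx => (hmem _ _).2 fun g =>
    sup_le_sup_left (vanish_anti (by exact_mod_cast h)) Γ ((hmem _ _).1 hx g)
  have hwf : WellFoundedGT {Δ // c.IsInvariantClosed ⊤ {1} Δ}ᵒᵈ := by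
    rw [wellFoundedGT_iff_monotone_chain_condition]
    intro f
    obtain ⟨N, hN⟩ := hdcc {1} (fun n => (OrderDual.ofDual (f n)).1) (fun a b hab => f.2 hab)
      fun n => (OrderDual.ofDual (f n)).2
    exact ⟨N, fun m hm => (Subtype.ext (hN m hm)).symm⟩
  obtain ⟨_, ⟨E, rfl⟩, hE⟩ := hwf.wf.has_min
    (Set.range fun E => (OrderDual.toDual ⟨S E, hS E⟩ : {Δ // c.IsInvariantClosed ⊤ {1} Δ}ᵒᵈ))
    ⟨_, ∅, rfl⟩
  refine ⟨E, le_antisymm (hΓS E) fun x hx => hΓ x fun Δ hΔ hle => ?_⟩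
  obtain ⟨E', hE'⟩ := c.exists_support hΔ
  -- Minimality of `S E` gives `S E = S (E ∪ E') ≤ S E'` for every finite `E'`, so `x` agrees on
  -- each finite set with an element of `Γ`.
  have hnot : ¬ S (E ∪ E') < S E := hE _ ⟨E ∪ E', rfl⟩
  have heq : S (E ∪ E') = S E := by
    by_contra hne
    exact hnot (lt_of_le_of_ne (hanti Finset.subset_union_left) hne)
  have hxE' : x ∈ S E' := hanti Finset.subset_union_right (heq.ge hx)
  have := (hmem _ _).1 hxE' 1
  have h1 : shiftHom 1 x = x := by funext z; simp
  rw [h1] at this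
  exact sup_le hle hE' this

end polycyclic

/-! ### The cylinder system of an algebraic group -/

namespace AlgGroup

variable {K : Type u} [Field K] {X : Type v}

/-- Restriction to a finite set as a group homomorphism. -/
def restrictHom {A : Type w} [Group A] (E : Finset X) : (X → A) →* (E → A) where
  toFun := restrictTo E
  map_one' := rfl
  map_mul' _ _ := rfl

@[simp]
lemma restrictHom_apply {A : Type w} [Group A] (E : Finset X) (x : X → A) (i : E) :
    restrictHom E x i = x i := rfl

/-- Reindexing as a group homomorphism. -/
def reindexHom {A : Type w} [Group A] {ι κ : Type*} (σ : κ → ι) : (ι → A) →* (κ → A) where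
  toFun x j := x (σ j)
  map_one' := rfl
  map_mul' _ _ := rfl

lemma restrictHom_surjective {A : Type w} [Group A] (E : Finset X) :
    Function.Surjective (restrictHom (A := A) E) := by
  classical
  exact fun y => ⟨fun i => if h : i ∈ E then y ⟨i, h⟩ else 1, funext fun i => by
    simp⟩

lemma comap_map_restrictHom {A : Type w} [Group A] (E : Finset X) (Γ : Subgroup (X → A)) :
    (Γ.map (restrictHom E)).comap (restrictHom E) = Γ ⊔ vanish (E : Set X) := by
  ext x
  rw [mem_sup_vanish]
  constructor
  · rintro ⟨γ, hγ, h⟩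
    exact ⟨γ, hγ, fun i hi => congrFun h ⟨i, hi⟩⟩
  · rintro ⟨γ, hγ, h⟩
    exact ⟨γ, hγ, funext fun i => h i.1 i.2⟩

lemma vanish_eq_comap {A : Type w} [Group A] (E : Finset X) :
    vanish (A := A) (E : Set X) = (⊥ : Subgroup (E → A)).comap (restrictHom E) := by
  rw [← Subgroup.map_bot (restrictHom E), comap_map_restrictHom, bot_sup_eq]

/-- The preimages in `V(K) ^ X` of algebraic subgroups of `V ^ E` for finite `E ⊆ X`. -/
def IsCylinder (V : AlgGroup K) (Γ : Subgroup (X → V.Points)) : Prop :=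
  ∃ (E : Finset X) (W : Subgroup (E → V.Points)),
    V.IsAlgSubgroup (W : Set (E → V.Points)) ∧ Γ = W.comap (restrictHom E)

variable {V : AlgGroup K}

/-- Pulling back along a coordinate projection enlarges the support; this brings several cylinders
to a common finite set of coordinates. -/
lemma IsCylinder.exists_comap_of_subset {E F : Finset X} (h : E ⊆ F)
    {W : Subgroup (E → V.Points)} (hW : V.IsAlgSubgroup (W : Set (E → V.Points))) :
    ∃ W' : Subgroup (F → V.Points), V.IsAlgSubgroup (W' : Set (F → V.Points)) ∧
      W.comap (restrictHom E) = W'.comap (restrictHom F) :=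
  ⟨W.comap (reindexHom fun i => ⟨i.1, h i.2⟩), hW.comap _ (V.isRegular_reindex _), rfl⟩

lemma isCylinder_of_isAlgSubgroup {E : Finset X} {W : Subgroup (E → V.Points)}
    (hW : V.IsAlgSubgroup (W : Set (E → V.Points))) : V.IsCylinder (W.comap (restrictHom E)) :=
  ⟨E, W, hW, rfl⟩

lemma IsCylinder.inf {Γ Δ : Subgroup (X → V.Points)} (hΓ : V.IsCylinder Γ) (hΔ : V.IsCylinder Δ) :
    V.IsCylinder (Γ ⊓ Δ) := by
  classical
  obtain ⟨E, W, hW, rfl⟩ := hΓ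
  obtain ⟨E', W', hW', rfl⟩ := hΔ
  obtain ⟨W₁, hW₁, h₁⟩ := IsCylinder.exists_comap_of_subset (Finset.subset_union_left (s₂ := E')) hW
  obtain ⟨W₂, hW₂, h₂⟩ := IsCylinder.exists_comap_of_subset (Finset.subset_union_right (s₁ := E)) hW'
  exact ⟨_, W₁ ⊓ W₂, IsAlgSubgroup.inf V hW₁ hW₂, by rw [h₁, h₂, Subgroup.comap_inf]⟩

lemma IsCylinder.exists_support {Γ : Subgroup (X → V.Points)} (hΓ : V.IsCylinder Γ) :
    ∃ E : Finset X, vanish (E : Set X) ≤ Γ := by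
  obtain ⟨E, W, hW, rfl⟩ := hΓ
  exact ⟨E, by rw [vanish_eq_comap]; exact Subgroup.comap_mono bot_le⟩

lemma IsCylinder.comap_shiftHom {G : Type v} [Group G] {Γ : Subgroup (G → V.Points)}
    (hΓ : V.IsCylinder Γ) (g : G) : V.IsCylinder (Γ.comap (shiftHom g)) := by
  classical
  obtain ⟨E, W, hW, rfl⟩ := hΓ
  let E' : Finset G := E.image (g⁻¹ * ·)
  let σ : E → E' := fun i => ⟨g⁻¹ * i.1, Finset.mem_image_of_mem _ i.2⟩
  exact ⟨E', W.comap (reindexHom σ), hW.comap _ (V.isRegular_reindex σ), rfl⟩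

variable [IsAlgClosed K]

/-- On a support enlarged to contain `E`, this is the image of an algebraic subgroup under a
projection, so `IsAlgSubgroup.map` applies. -/
lemma IsCylinder.isAlgSubgroup_map {Γ : Subgroup (X → V.Points)} (hΓ : V.IsCylinder Γ)
    (E : Finset X) : V.IsAlgSubgroup (Γ.map (restrictHom E) : Set (E → V.Points)) := by
  classical
  obtain ⟨E', W, hW, rfl⟩ := hΓ
  obtain ⟨W', hW', h⟩ := IsCylinder.exists_comap_of_subset (Finset.subset_union_left (s₂ := E)) hW
  have hres : restrictHom (A := V.Points) E =
      (reindexHom fun i : E => (⟨i.1, Finset.mem_union_right E' i.2⟩ : ↥(E' ∪ E))).comp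
        (restrictHom (E' ∪ E)) := rfl
  rw [h, hres, ← Subgroup.map_map,
    Subgroup.map_comap_eq_self_of_surjective (restrictHom_surjective _)]
  exact hW'.map _ (V.isRegular_reindex _)

lemma IsCylinder.sup_vanish {Γ : Subgroup (X → V.Points)} (hΓ : V.IsCylinder Γ) (E : Finset X) :
    V.IsCylinder (Γ ⊔ vanish (E : Set X)) := by
  rw [← comap_map_restrictHom]
  exact isCylinder_of_isAlgSubgroup (hΓ.isAlgSubgroup_map E)

/-- The system of algebraic cylinder subgroups of `V(K) ^ X`. -/
def cylinderSystem (V : AlgGroup K) (X : Type v) : CylinderSystem X V.Points where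
  cyl := V.IsCylinder
  exists_support := IsCylinder.exists_support
  inf := IsCylinder.inf
  cyl_vanish E := by
    rw [vanish_eq_comap]
    exact isCylinder_of_isAlgSubgroup V.isAlgSubgroup_bot
  sup_vanish := IsCylinder.sup_vanish
  exists_minimal E 𝒢 hne h := by
    -- Subgroups containing `vanish E` are recovered from their restrictions to `E`, so minimality
    -- can be tested among algebraic subgroups of `V^E`.
    have hwf := V.wellFoundedLT_isAlgSubgroup E
    obtain ⟨_, ⟨Γ, hΓ, rfl⟩, hmin⟩ := hwf.wf.has_min
      {W | ∃ Γ, ∃ hΓ : Γ ∈ 𝒢, W = ⟨Γ.map (restrictHom E), (h Γ hΓ).1.isAlgSubgroup_map E⟩}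
      ⟨_, hne.some, hne.some_mem, rfl⟩
    refine ⟨Γ, hΓ, fun Δ hΔ hle => ?_⟩
    have hnot : ¬ Δ.map (restrictHom E) < Γ.map (restrictHom E) := hmin _ ⟨Δ, hΔ, rfl⟩
    have heq : Γ.map (restrictHom E) = Δ.map (restrictHom E) := by
      by_contra hne
      exact hnot (lt_of_le_of_ne (Subgroup.map_mono hle) (Ne.symm hne))
    have := congrArg (Subgroup.comap (restrictHom E)) heq
    rw [comap_map_restrictHom, comap_map_restrictHom, sup_eq_left.2 (h Γ hΓ).2,
      sup_eq_left.2 (h Δ hΔ).2] at this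
    exact this.le

end AlgGroup

/-! ### Algebraic group sofic subshifts -/

section sofic

open AlgGroup

variable {G : Type v} [Group G] {K : Type u} [Field K] {U V : AlgGroup K}

/-- A subshift of finite type defined by a subgroup is a subgroup. -/
lemma subshiftOfFiniteType_coe {A : Type w} [Group A] (D : Finset G) (W : Subgroup (D → A)) :
    subshiftOfFiniteType D (W : Set (D → A)) =
      ((⨅ g : G, (W.comap (restrictHom D)).comap (shiftHom g) : Subgroup (G → A)) :
        Set (G → A)) := by
  ext x
  rw [SetLike.mem_coe, Subgroup.mem_iInf]
  exact ⟨fun h g => inv_inv g ▸ h g⁻¹, fun h g => h g⁻¹⟩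

variable {M : Finset G} {μ : (M → U.Points) → V.Points}

/-- A cellular automaton with a multiplicative local rule is a group homomorphism. -/
def cellularHom (hμ : ∀ x y, μ (x * y) = μ x * μ y) : (G → U.Points) →* (G → V.Points) :=
  .mk' (fun x g => μ (restrictTo M (shift g⁻¹ x))) fun _ _ => funext fun _ => hμ _ _

/-- The homomorphism on finite windows induced by a local rule. -/
def localHom (hμ : ∀ x y, μ (x * y) = μ x * μ y) {E F : Finset G}
    (hF : ∀ e ∈ E, ∀ m ∈ M, e * m ∈ F) : (F → U.Points) →* (E → V.Points) :=
  .mk' (fun y e => μ fun m => y ⟨e.1 * m.1, hF _ e.2 _ m.2⟩) fun _ _ => funext fun _ => hμ _ _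

lemma isRegular_localHom (hμ : IsAlgHom U V μ) {E F : Finset G}
    (hF : ∀ e ∈ E, ∀ m ∈ M, e * m ∈ F) : IsRegular U V (localHom hμ.1 hF) := by
  obtain ⟨_, f, hf⟩ := hμ
  refine isRegular_of_coord fun e => ?_
  obtain ⟨r, hr⟩ := U.isRegular_reindex
    (fun m : M => (⟨e.1 * m.1, hF _ e.2 _ m.2⟩ : F))
  exact ⟨r ≫ f, fun x => by rw [← Category.assoc, ← hr, ← hf]; rfl⟩

lemma restrictHom_comp_cellularHom (hμ : ∀ x y, μ (x * y) = μ x * μ y) {E F : Finset G}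
    (hF : ∀ e ∈ E, ∀ m ∈ M, e * m ∈ F) :
    (restrictHom E).comp (cellularHom hμ) = (localHom hμ hF).comp (restrictHom F) := by
  refine MonoidHom.ext fun x => funext fun e => congrArg μ (funext fun m => ?_)
  simp [restrictTo, shift]

/-- The output on `E` depends only on the input on `E M`, so the cylinder conditions reduce to the
regular homomorphism `localHom` between finite powers. -/
lemma isClosedSubgroup_map_cellularHom [IsAlgClosed K] (hμ : IsAlgHom U V μ)
    {Γ : Subgroup (G → U.Points)}
    (hΓ : (U.cylinderSystem G).IsClosedSubgroup Γ) :
    (V.cylinderSystem G).IsClosedSubgroup (Γ.map (cellularHom hμ.1)) := by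
  classical
  have hF : ∀ E : Finset G, ∀ e ∈ E, ∀ m ∈ M, e * m ∈ Finset.image₂ (· * ·) E M :=
    fun E e he m hm => Finset.mem_image₂_of_mem he hm
  have := hΓ.map_sup_vanish (d := V.cylinderSystem G) (cellularHom hμ.1)
    (fun E => by
      rw [vanish_eq_comap, Subgroup.comap_comap, restrictHom_comp_cellularHom hμ.1 (hF E),
        ← Subgroup.comap_comap]
      exact isCylinder_of_isAlgSubgroup
        (V.isAlgSubgroup_bot.comap _ (isRegular_localHom hμ (hF E))))
    (fun Δ hΔ E => by
      rw [← comap_map_restrictHom, Subgroup.map_map, restrictHom_comp_cellularHom hμ.1 (hF E),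
        ← Subgroup.map_map]
      exact isCylinder_of_isAlgSubgroup
        ((IsCylinder.isAlgSubgroup_map hΔ _).map _ (isRegular_localHom hμ (hF E))))
    Set.univ
  have hv : vanish (A := V.Points) (Set.univ : Set G) = ⊥ :=
    (Subgroup.eq_bot_iff_forall _).2 fun x hx => funext fun i => hx i trivial
  rwa [hv, sup_bot_eq] at this

end sofic

end

theorem mainTheorem7 {G : Type v} [Group G] (hG : IsPolycyclicByFinite G)
    {K : Type u} [Field K] [IsAlgClosed K] (V : AlgGroup K) (S : Set (G → V.Points))
    (hS : IsAlgGroupSofic G V S) :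
    IsAlgGroupSFT G V S := by
  obtain ⟨U, _, τ, ⟨D, _, ⟨⟨W, rfl⟩, hW⟩, rfl⟩, ⟨M, μ, hμ, hτ⟩, rfl⟩ := hS
  set Γ : Subgroup (G → U.Points) :=
    ⨅ g : G, (W.comap (AlgGroup.restrictHom D)).comap (shiftHom g)
  have hτ' : τ = cellularHom hμ.1 := funext fun x => funext fun g => hτ x g
  have himg : τ '' subshiftOfFiniteType D (W : Set (D → U.Points)) =
      (Γ.map (cellularHom hμ.1) : Set (G → V.Points)) := by
    rw [subshiftOfFiniteType_coe, hτ', Subgroup.coe_map]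
  have hclosed : (U.cylinderSystem G).IsClosedSubgroup Γ :=
    CylinderSystem.IsClosedSubgroup.iInf fun g => CylinderSystem.isClosedSubgroup_of_cyl
      ((AlgGroup.isCylinder_of_isAlgSubgroup ⟨⟨W, rfl⟩, hW⟩).comap_shiftHom g)
  have himgclosed := isClosedSubgroup_map_cellularHom hμ hclosed
  have hinv : ∀ g, Γ.map (cellularHom hμ.1) ≤
      (Γ.map (cellularHom hμ.1)).comap (shiftHom g) := by
    rintro g _ ⟨x, hx, rfl⟩
    refine ⟨shiftHom g x, ?_, ?_⟩
    · refine Subgroup.mem_iInf.2 fun h => ?_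
      have := Subgroup.mem_iInf.1 hx (h * g)
      have e : shiftHom h (shiftHom g x) = shiftHom (h * g) x := by
        funext z
        simp [mul_assoc]
      rwa [Subgroup.mem_comap, e]
    · funext z
      simp only [cellularHom, MonoidHom.mk'_apply, shiftHom_apply]
      congr 1
      funext m
      simp [restrictTo, shift, shiftHom_apply, mul_assoc]
  obtain ⟨E, hE⟩ := (V.cylinderSystem G).exists_window (fun Δ hΔ g => hΔ.comap_shiftHom g)
    ((V.cylinderSystem G).dcc_top_of_isPolycyclicByFinite hG) himgclosed hinv
  -- The defining subgroup is the projection of the image to `E`; it is algebraic because a closed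
  -- subgroup with finite support is a cylinder.
  have hcyl : V.IsCylinder (Γ.map (cellularHom hμ.1) ⊔ vanish (E : Set G)) :=
    (himgclosed.sup_vanish _).cyl_of_vanish_le E le_sup_right
  refine ⟨E, _, hcyl.isAlgSubgroup_map E, ?_⟩
  rw [himg, subshiftOfFiniteType_coe, AlgGroup.comap_map_restrictHom, sup_assoc, sup_idem, ← hE]
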